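/- **Riemann mapping theorem.** Let $\Omega \subsetneq \mathbb{C}$ be a simply connected domain, that is, a connected open set, different from $\mathbb{C}$, in which every closed curve is homotopic within $\Omega$ to a point, and let $a \in \Omega$. Then there is a conformal map $f$ from $\Omega$ onto the unit disk $\mathbb{D} = \{z \in \mathbb{C} : |z| < 1\}$ with $f(a) = 0$; that is, there is a holomorphic function $f$ on $\Omega$ with nowhere vanishing derivative that maps $\Omega$ bijectively onto $\mathbb{D}$ and satisfies $f(a) = 0$. -/

import Mathlib

/-!
The proof is Koebe's extremal argument. Among the conformal embeddings of `Ω` into the unit disk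
that send `a` to `0`, take one whose derivative at `a` has the largest modulus; it is onto.

The class is not empty: as `Ω` is simply connected and omits a point `b`, there is a branch of
`√(z - b)` on `Ω`, and its image misses a disk (`exists_isDiskEmbedding`).

A maximum exists (`exists_isDiskEmbedding_norm_deriv_max`): the moduli `‖deriv f a‖` are bounded by
the Schwarz lemma, an ultrafilter along which they approach their supremum has a locally uniform
limit by Montel's theorem (`exists_tendstoLocallyUniformlyOn`), and by Hurwitz's theorem
(`eventually_eq_zero_of_tendstoLocallyUniformlyOn`) this limit, being nonconstant, is again an
embedding with nonvanishing derivative.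

The maximum is onto (`IsDiskEmbedding.exists_norm_deriv_lt`): if `g` omits `w` in the disk, then
`diskAut w ∘ g` has no zeros, so it has a square root `h` on `Ω`, and `diskAut (h a) ∘ h` is an
embedding sending `a` to `0` whose derivative there is larger by the factor
`(1 + ‖w‖) / (2 * √‖w‖) > 1`.
-/

open Set Filter Topology Metric

namespace RiemannMapping

/-! ### Disk embeddings -/

/-- A conformal embedding of `Ω` into the open unit disk: an injective map with nonvanishing complex
derivative on `Ω`. Since `deriv` is `0` where a function is not differentiable, `deriv_ne_zero`
includes holomorphy on `Ω`. -/
structure IsDiskEmbedding (Ω : Set ℂ) (f : ℂ → ℂ) : Prop where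
  mapsTo : MapsTo f Ω (ball 0 1)
  injOn : InjOn f Ω
  deriv_ne_zero : ∀ z ∈ Ω, deriv f z ≠ 0

theorem IsDiskEmbedding.differentiableAt {Ω : Set ℂ} {f : ℂ → ℂ} (hf : IsDiskEmbedding Ω f)
    {z : ℂ} (hz : z ∈ Ω) : DifferentiableAt ℂ f z :=
  differentiableAt_of_deriv_ne_zero (hf.deriv_ne_zero z hz)

theorem IsDiskEmbedding.differentiableOn {Ω : Set ℂ} {f : ℂ → ℂ} (hf : IsDiskEmbedding Ω f) :
    DifferentiableOn ℂ f Ω := fun _ hz ↦ (hf.differentiableAt hz).differentiableWithinAt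

/-! ### Disk automorphisms -/

/-- The automorphism `z ↦ (z - w) / (1 - conj w * z)` of the unit disk, sending `w` to `0`. -/
noncomputable def diskAut (w z : ℂ) : ℂ := (z - w) / (1 - (starRingEnd ℂ) w * z)

@[simp] theorem diskAut_self (w : ℂ) : diskAut w w = 0 := by simp [diskAut]

theorem one_sub_conj_mul_ne_zero {w z : ℂ} (hw : ‖w‖ < 1) (hz : ‖z‖ < 1) :
    1 - (starRingEnd ℂ) w * z ≠ 0 := by
  intro h
  have h1 : (starRingEnd ℂ) w * z = 1 := (sub_eq_zero.mp h).symm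
  have h2 : ‖w‖ * ‖z‖ = 1 := by simpa using congrArg norm h1
  nlinarith [norm_nonneg w, norm_nonneg z]

theorem norm_diskAut_lt_one {w z : ℂ} (hw : ‖w‖ < 1) (hz : ‖z‖ < 1) : ‖diskAut w z‖ < 1 := by
  have h0 := one_sub_conj_mul_ne_zero hw hz
  rw [diskAut, norm_div, div_lt_one (norm_pos_iff.mpr h0)]
  refine lt_of_pow_lt_pow_left₀ 2 (norm_nonneg _) ?_
  have hw' : ‖w‖ ^ 2 < 1 := by nlinarith [norm_nonneg w]
  have hz' : ‖z‖ ^ 2 < 1 := by nlinarith [norm_nonneg z]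
  -- `‖1 - conj w * z‖² - ‖z - w‖² = (1 - ‖w‖²) * (1 - ‖z‖²)`
  have key : ‖1 - (starRingEnd ℂ) w * z‖ ^ 2 - ‖z - w‖ ^ 2 = (1 - ‖w‖ ^ 2) * (1 - ‖z‖ ^ 2) := by
    simp only [← Complex.normSq_eq_norm_sq, Complex.normSq_apply]
    simp
    ring
  nlinarith

theorem hasDerivAt_diskAut {w z : ℂ} (hw : ‖w‖ < 1) (hz : ‖z‖ < 1) :
    HasDerivAt (diskAut w) ((1 - (‖w‖ : ℂ) ^ 2) / (1 - (starRingEnd ℂ) w * z) ^ 2) z := by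
  have h0 := one_sub_conj_mul_ne_zero hw hz
  have h := ((hasDerivAt_id z).sub_const w).div
    (((hasDerivAt_id z).const_mul ((starRingEnd ℂ) w)).const_sub 1) h0
  refine h.congr_deriv ?_
  rw [← Complex.conj_mul']
  simp only [id]
  congr 1
  ring

theorem diskAut_injOn {w : ℂ} (hw : ‖w‖ < 1) : InjOn (diskAut w) (ball 0 1) := by
  intro x hx y hy h
  rw [mem_ball_zero_iff] at hx hy
  rw [diskAut, diskAut, div_eq_div_iff (one_sub_conj_mul_ne_zero hw hx)
    (one_sub_conj_mul_ne_zero hw hy)] at h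
  have h1 : (1 - (starRingEnd ℂ) w * w) * (x - y) = 0 := by linear_combination h
  exact sub_eq_zero.mp ((mul_eq_zero.mp h1).resolve_left (one_sub_conj_mul_ne_zero hw hw))

theorem diskAut_ne_zero {w z : ℂ} (hw : ‖w‖ < 1) (hz : ‖z‖ < 1) (h : z ≠ w) :
    diskAut w z ≠ 0 :=
  div_ne_zero (sub_ne_zero.mpr h) (one_sub_conj_mul_ne_zero hw hz)

theorem one_sub_norm_sq_ne_zero {w : ℂ} (hw : ‖w‖ < 1) : (1 - (‖w‖ : ℂ) ^ 2) ≠ 0 := by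
  rw [← Complex.conj_mul']
  exact one_sub_conj_mul_ne_zero hw hw

theorem IsDiskEmbedding.hasDerivAt_diskAut_comp {Ω : Set ℂ} {f : ℂ → ℂ}
    (hf : IsDiskEmbedding Ω f) {w z : ℂ} (hw : ‖w‖ < 1) (hz : z ∈ Ω) :
    HasDerivAt (diskAut w ∘ f)
      ((1 - (‖w‖ : ℂ) ^ 2) / (1 - (starRingEnd ℂ) w * f z) ^ 2 * deriv f z) z :=
  (hasDerivAt_diskAut hw (mem_ball_zero_iff.mp (hf.mapsTo hz))).comp z
    (hf.differentiableAt hz).hasDerivAt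

theorem IsDiskEmbedding.diskAut_comp {Ω : Set ℂ} {f : ℂ → ℂ}
    (hf : IsDiskEmbedding Ω f) {w : ℂ} (hw : ‖w‖ < 1) : IsDiskEmbedding Ω (diskAut w ∘ f) where
  mapsTo z hz := mem_ball_zero_iff.mpr
    (norm_diskAut_lt_one hw (mem_ball_zero_iff.mp (hf.mapsTo hz)))
  injOn := (diskAut_injOn hw).comp hf.injOn hf.mapsTo
  deriv_ne_zero z hz := by
    rw [(hf.hasDerivAt_diskAut_comp hw hz).deriv]
    exact mul_ne_zero (div_ne_zero (one_sub_norm_sq_ne_zero hw) (pow_ne_zero 2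
      (one_sub_conj_mul_ne_zero hw (mem_ball_zero_iff.mp (hf.mapsTo hz)))))
      (hf.deriv_ne_zero z hz)

/-! ### Square roots -/

/-- A continuous square root of a differentiable function is differentiable where it does not
vanish. -/
theorem hasDerivAt_of_sq_eq {h p : ℂ → ℂ} {p' z : ℂ} (hc : ContinuousAt h z)
    (hsq : ∀ y, h y ^ 2 = p y) (hp : HasDerivAt p p' z) (h0 : h z ≠ 0) :
    HasDerivAt h (p' / (2 * h z)) z := by
  rw [hasDerivAt_iff_tendsto_slope] at hp ⊢
  have hsum : Tendsto (fun y ↦ h y + h z) (𝓝 z) (𝓝 (2 * h z)) := by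
    simpa [two_mul] using hc.tendsto.add_const (h z)
  have h2 : 2 * h z ≠ 0 := mul_ne_zero two_ne_zero h0
  refine (hp.div (hsum.mono_left nhdsWithin_le_nhds) h2).congr' ?_
  filter_upwards [(hsum.eventually_ne h2).filter_mono nhdsWithin_le_nhds] with y hy
  -- `p y - p z = (h y - h z) * (h y + h z)`
  rw [Pi.div_apply, slope_def_field, slope_def_field, ← hsq, ← hsq, div_eq_iff hy]
  ring

theorem exists_sq_eq {Ω : Set ℂ} (hΩo : IsOpen Ω) (hΩc : IsSimplyConnected Ω) {p : ℂ → ℂ}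
    (hp : ∀ z ∈ Ω, DifferentiableAt ℂ p z) (h0 : ∀ z ∈ Ω, p z ≠ 0) :
    ∃ h : ℂ → ℂ, (∀ z, h z ^ 2 = p z) ∧ (∀ z ∈ Ω, h z ≠ 0) ∧
      ∀ z ∈ Ω, HasDerivAt h (deriv p z / (2 * h z)) z := by
  obtain ⟨h, hc, hsq⟩ := Complex.exists_continuousOn_pow_eq hΩc hΩo
    (fun z hz ↦ (hp z hz).continuousAt.continuousWithinAt)
    (by rintro ⟨z, hz, hz0⟩; exact h0 z hz hz0) two_ne_zero
  have hne : ∀ z ∈ Ω, h z ≠ 0 := fun z hz hz0 ↦ h0 z hz (by rw [← hsq, hz0]; simp)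
  exact ⟨h, hsq, hne, fun z hz ↦ hasDerivAt_of_sq_eq (hc.continuousAt (hΩo.mem_nhds hz)) hsq
    (hp z hz).hasDerivAt (hne z hz)⟩

/-- A proper simply connected domain embeds conformally into the disk: a branch `h` of
`√(z - b)`, with `b ∉ Ω`, omits a neighbourhood of `-h a`, so that `c / (h + h a)` is bounded. -/
theorem exists_isDiskEmbedding {Ω : Set ℂ} (hΩo : IsOpen Ω) (hΩc : IsSimplyConnected Ω)
    (hΩ : Ω ≠ univ) {a : ℂ} (ha : a ∈ Ω) : ∃ f, IsDiskEmbedding Ω f := by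
  obtain ⟨b, hb⟩ := (ne_univ_iff_exists_notMem Ω).mp hΩ
  have hd : ∀ z, HasDerivAt (fun z ↦ z - b) 1 z := fun z ↦ (hasDerivAt_id z).sub_const b
  obtain ⟨h, hsq, hne, hder⟩ := exists_sq_eq hΩo hΩc (p := fun z ↦ z - b)
    (fun z _ ↦ (hd z).differentiableAt) (fun z hz ↦ sub_ne_zero.mpr (ne_of_mem_of_not_mem hz hb))
  simp only [(hd _).deriv] at hder
  have hinj : ∀ {z y}, h z ^ 2 = h y ^ 2 → z = y := fun {z y} e ↦ by
    rw [hsq, hsq] at e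
    exact sub_left_injective e
  have hdne : ∀ z ∈ Ω, 1 / (2 * h z) ≠ 0 := fun z hz ↦ by simpa using hne z hz
  -- `h` is open at `a`, so `h '' Ω` contains a ball around `h a`.
  have himg : h '' Ω ∈ 𝓝 (h a) := by
    have han : AnalyticAt ℂ h a := by
      refine DifferentiableOn.analyticAt (s := Ω) (fun z hz ↦ ?_) (hΩo.mem_nhds ha)
      exact (hder z hz).differentiableAt.differentiableWithinAt
    rcases han.eventually_constant_or_nhds_le_map_nhds with hconst | hle
    · refine absurd ?_ (hdne a ha)
      rw [← (hder a ha).deriv, EventuallyEq.deriv_eq hconst, deriv_const]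
    · exact hle (image_mem_map (hΩo.mem_nhds ha))
  obtain ⟨r, hr, hball⟩ := Metric.mem_nhds_iff.mp himg
  -- A value of `h` within `r` of `-h a` would be the negative of another value of `h`.
  have hfar : ∀ z ∈ Ω, r ≤ ‖h z + h a‖ := by
    intro z hz
    by_contra! hlt
    obtain ⟨y, hy, hyz⟩ : -h z ∈ h '' Ω := hball (by
      rw [mem_ball, dist_eq_norm, ← norm_neg]
      convert! hlt using 2
      ring)
    obtain rfl : y = z := hinj (by rw [hyz]; ring)
    exact hne y hy (by linear_combination hyz / 2)
  have hsum : ∀ z ∈ Ω, h z + h a ≠ 0 := fun z hz ↦ norm_pos_iff.mp (hr.trans_le (hfar z hz))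
  have hr2 : ((r / 2 : ℝ) : ℂ) ≠ 0 := by exact_mod_cast (half_pos hr).ne'
  refine ⟨fun z ↦ ((r / 2 : ℝ) : ℂ) / (h z + h a), fun z hz ↦ ?_, fun z hz y hy e ↦ ?_,
    fun z hz ↦ ?_⟩
  · rw [mem_ball_zero_iff, norm_div, Complex.norm_real, Real.norm_of_nonneg (half_pos hr).le,
      div_lt_one (norm_pos_iff.mpr (hsum z hz))]
    linarith [hfar z hz]
  · have e' : h z + h a = h y + h a := by
      rw [div_eq_div_iff (hsum z hz) (hsum y hy)] at e
      exact (mul_left_cancel₀ hr2 e).symm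
    exact hinj (by rw [add_right_cancel e'])
  · rw [((hasDerivAt_const z ((r / 2 : ℝ) : ℂ)).fun_div ((hder z hz).add_const (h a))
      (hsum z hz)).deriv, zero_mul, zero_sub]
    exact div_ne_zero (neg_ne_zero.mpr (mul_ne_zero hr2 (hdne z hz))) (pow_ne_zero 2 (hsum z hz))

/-- Koebe's square root trick: an embedding that sends the base point to `0` and omits a
point of the disk does not maximize the derivative at the base point. -/
theorem IsDiskEmbedding.exists_norm_deriv_lt {Ω : Set ℂ} (hΩo : IsOpen Ω)
    (hΩc : IsSimplyConnected Ω) {a : ℂ} (ha : a ∈ Ω) {g : ℂ → ℂ} (hg : IsDiskEmbedding Ω g)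
    (hga : g a = 0) {w : ℂ} (hw : ‖w‖ < 1) (hwg : ∀ z ∈ Ω, g z ≠ w) :
    ∃ f, IsDiskEmbedding Ω f ∧ f a = 0 ∧ ‖deriv g a‖ < ‖deriv f a‖ := by
  have hp := hg.diskAut_comp hw
  obtain ⟨h, hsq, hne, hder⟩ := exists_sq_eq hΩo hΩc (fun z hz ↦ hp.differentiableAt hz)
    (fun z hz ↦ diskAut_ne_zero hw (mem_ball_zero_iff.mp (hg.mapsTo hz)) (hwg z hz))
  have hemb : IsDiskEmbedding Ω h := by
    refine ⟨fun z hz ↦ ?_, fun z hz y hy e ↦ hp.injOn hz hy ?_, fun z hz ↦ ?_⟩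
    · have h1 := mem_ball_zero_iff.mp (hp.mapsTo hz)
      rw [← hsq, norm_pow] at h1
      exact mem_ball_zero_iff.mpr ((pow_lt_one_iff_of_nonneg (norm_nonneg _) two_ne_zero).mp h1)
    · rw [← hsq, ← hsq, e]
    · rw [(hder z hz).deriv]
      exact div_ne_zero (hp.deriv_ne_zero z hz) (mul_ne_zero two_ne_zero (hne z hz))
  have hha : ‖h a‖ < 1 := mem_ball_zero_iff.mp (hemb.mapsTo ha)
  refine ⟨diskAut (h a) ∘ h, hemb.diskAut_comp hha, diskAut_self _, ?_⟩
  have hpos : 0 < ‖h a‖ := norm_pos_iff.mpr (hne a ha)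
  -- With `s = ‖h a‖`, so that `s ^ 2 = ‖w‖`, the derivative at `a` is multiplied by
  -- `(1 + s ^ 2) / (2 * s) > 1`.
  have hws : ‖w‖ = ‖h a‖ ^ 2 := by
    rw [← norm_pow, hsq]
    simp [diskAut, hga]
  have hcast : ∀ t : ℝ, 0 ≤ 1 - t ^ 2 → ‖(1 - (t : ℂ) ^ 2)‖ = 1 - t ^ 2 := fun t ht ↦ by
    rw [← Complex.ofReal_one, ← Complex.ofReal_pow, ← Complex.ofReal_sub, Complex.norm_real,
      Real.norm_of_nonneg ht]
  have hs1 : 0 < 1 - ‖h a‖ ^ 2 := by nlinarith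
  have hw1 : 0 ≤ 1 - ‖w‖ ^ 2 := by nlinarith [norm_nonneg w]
  have hga' : 0 < ‖deriv g a‖ := norm_pos_iff.mpr (hg.deriv_ne_zero a ha)
  rw [(hemb.hasDerivAt_diskAut_comp hha ha).deriv, (hder a ha).deriv,
    (hg.hasDerivAt_diskAut_comp hw ha).deriv, hga, Complex.conj_mul']
  simp only [norm_mul, norm_div, norm_pow, hcast _ hs1.le, hcast _ hw1, mul_zero, sub_zero,
    one_pow, div_one, Complex.norm_ofNat]
  rw [hws]
  set s := ‖h a‖
  have hfac : (1 - s ^ 2) / (1 - s ^ 2) ^ 2 * ((1 - (s ^ 2) ^ 2) * ‖deriv g a‖ / (2 * s)) =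
      (1 + s ^ 2) / (2 * s) * ‖deriv g a‖ := by
    field_simp
    ring
  rw [hfac]
  refine lt_mul_of_one_lt_left hga' ((one_lt_div (by positivity)).mpr ?_)
  nlinarith [sq_pos_of_pos (sub_pos.mpr hha)]

/-! ### Limits of holomorphic functions -/

/-- **Hurwitz's theorem**: if a locally uniform limit of zero-free holomorphic functions has a zero,
then it vanishes near that zero. -/
theorem eventually_eq_zero_of_tendstoLocallyUniformlyOn {ι : Type*} {φ : Filter ι} [φ.NeBot]
    {U : Set ℂ} (hU : IsOpen U) {F : ι → ℂ → ℂ} {g : ℂ → ℂ}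
    (hF : TendstoLocallyUniformlyOn F g φ U) (hd : ∀ᶠ i in φ, DifferentiableOn ℂ (F i) U)
    (h0 : ∀ᶠ i in φ, ∀ z ∈ U, F i z ≠ 0) {c : ℂ} (hc : c ∈ U) (hgc : g c = 0) :
    ∀ᶠ z in 𝓝 c, g z = 0 := by
  have hg : DifferentiableOn ℂ g U := hF.differentiableOn hd hU
  refine ((hg.analyticAt (hU.mem_nhds hc)).eventually_eq_zero_or_eventually_ne_zero).resolve_right
    fun hne ↦ ?_
  obtain ⟨r, hr, hball⟩ := Metric.nhds_basis_closedBall.mem_iff.mp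
    (inter_mem (hU.mem_nhds hc) (eventually_nhdsWithin_iff.mp hne))
  have hsub : closedBall c r ⊆ U := hball.trans inter_subset_left
  obtain ⟨x, hx, hmin⟩ := (isCompact_sphere c r).exists_isMinOn
    (NormedSpace.sphere_nonempty.mpr hr.le)
    (hg.continuousOn.norm.mono (sphere_subset_closedBall.trans hsub))
  have hδ : 0 < ‖g x‖ := norm_pos_iff.mpr
    ((hball (sphere_subset_closedBall hx)).2 (ne_of_mem_sphere hx hr.ne'))
  have hunif := (tendstoLocallyUniformlyOn_iff_forall_isCompact hU).mp hF _ hsub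
    (isCompact_closedBall c r)
  obtain ⟨i, hi, hdi, h0i⟩ :=
    ((Metric.tendstoUniformlyOn_iff.mp hunif (‖g x‖ / 2) (half_pos hδ)).and (hd.and h0)).exists
  -- `F i` is larger on the circle than at the centre, against the maximum principle for `1 / F i`.
  have hmax : ‖(F i c)⁻¹‖ ≤ (‖g x‖ / 2)⁻¹ := by
    refine Complex.norm_le_of_forall_mem_frontier_norm_le (f := fun z ↦ (F i z)⁻¹)
      (U := ball c r) isBounded_ball ?_ ?_ (subset_closure (mem_ball_self hr))
    · refine DifferentiableOn.diffContOnCl ?_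
      rw [closure_ball c hr.ne']
      exact (hdi.mono hsub).inv fun z hz ↦ h0i z (hsub hz)
    · intro z hz
      rw [frontier_ball c hr.ne'] at hz
      rw [norm_inv]
      refine inv_anti₀ (half_pos hδ) ?_
      have h1 : ‖g x‖ ≤ ‖g z‖ := hmin hz
      have h2 := hi z (sphere_subset_closedBall hz)
      rw [dist_eq_norm] at h2
      linarith [norm_sub_norm_le (g z) (F i z)]
  have hcen := hi c (mem_closedBall_self hr.le)
  rw [hgc, dist_zero_left] at hcen
  rw [norm_inv] at hmax
  exact absurd hmax (not_le.mpr (inv_strictAnti₀ (norm_pos_iff.mpr (h0i c hc)) hcen))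

/-- **Montel's theorem**, for ultrafilters: a family of holomorphic maps of `U` into the unit disk
converges locally uniformly along every ultrafilter. Pointwise limits exist since the closed disk is
compact, and the family is equicontinuous by the Schwarz lemma. -/
theorem exists_tendstoLocallyUniformlyOn {ι : Type*} (u : Ultrafilter ι) {U : Set ℂ}
    (hU : IsOpen U) {F : ι → ℂ → ℂ} (hd : ∀ i, DifferentiableOn ℂ (F i) U)
    (hF : ∀ i, MapsTo (F i) U (ball 0 1)) :
    ∃ g : ℂ → ℂ, TendstoLocallyUniformlyOn F g u U := by
  have hpt : ∀ z : ℂ, ∃ y, z ∈ U → Tendsto (F · z) u (𝓝 y) := by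
    intro z
    by_cases hz : z ∈ U
    · obtain ⟨y, -, hy⟩ := (isCompact_closedBall (0 : ℂ) 1).ultrafilter_le_nhds (u.map (F · z))
        (le_principal_iff.mpr (mem_map.mpr
          (univ_mem' fun i ↦ ball_subset_closedBall (hF i hz))))
      exact ⟨y, fun _ ↦ hy⟩
    · exact ⟨0, fun h ↦ absurd h hz⟩
  choose g hg using hpt
  refine ⟨g, ?_⟩
  have heq : ∀ z ∈ U, EquicontinuousAt F z := by
    intro c hc
    obtain ⟨r, hr, hball⟩ := Metric.isOpen_iff.mp hU c hc
    refine Metric.equicontinuousAt_of_continuity_modulus (fun z ↦ 2 / r * dist z c) ?_ F ?_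
    · have : Continuous fun z ↦ 2 / r * dist z c := by fun_prop
      simpa using this.tendsto c
    · filter_upwards [ball_mem_nhds c hr] with z hz i
      rw [dist_comm]
      refine Complex.dist_le_div_mul_dist_of_mapsTo_ball ((hd i).mono hball) (fun y hy ↦ ?_) hz
      have h1 := mem_ball_zero_iff.mp (hF i (hball hy))
      have h2 := mem_ball_zero_iff.mp (hF i hc)
      rw [mem_closedBall, dist_eq_norm]
      linarith [norm_sub_le (F i y) (F i c)]
  rw [tendstoLocallyUniformlyOn_iff_forall_isCompact hU]
  intro K hKU hK
  have := (EquicontinuousOn.tendsto_uniformOnFun_iff_pi' (𝔖 := {K}) (F := F)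
    (by rintro _ rfl; exact hK)
    (by rintro _ rfl; exact fun z hz ↦ (heq z (hKU hz)).equicontinuousWithinAt _) u g).mpr
    (by
      rw [tendsto_pi_nhds]
      rintro ⟨z, hz⟩
      exact hg z (hKU (by simpa using hz)))
  exact UniformOnFun.tendsto_iff_tendstoUniformlyOn.mp this K rfl

/-- A locally uniform limit of disk embeddings of a domain is constant or a disk embedding; here
nonconstancy is witnessed by a nonzero derivative. -/
theorem IsDiskEmbedding.of_tendstoLocallyUniformlyOn {ι : Type*} {φ : Filter ι} [φ.NeBot]
    {Ω : Set ℂ} (hΩo : IsOpen Ω) (hΩc : IsPreconnected Ω) {F : ι → ℂ → ℂ} {g : ℂ → ℂ}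
    (hF : TendstoLocallyUniformlyOn F g φ Ω) (hemb : ∀ i, IsDiskEmbedding Ω (F i))
    {a : ℂ} (ha : a ∈ Ω) (hga : deriv g a ≠ 0) : IsDiskEmbedding Ω g := by
  have hd : ∀ᶠ i in φ, DifferentiableOn ℂ (F i) Ω := .of_forall fun i ↦ (hemb i).differentiableOn
  have hg : DifferentiableOn ℂ g Ω := hF.differentiableOn hd hΩo
  have han : AnalyticOnNhd ℂ g Ω := hg.analyticOnNhd hΩo
  have hnc : ∀ y, ¬ ∀ z ∈ Ω, g z = y := by
    intro y hy
    refine hga ?_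
    have : g =ᶠ[𝓝 a] fun _ ↦ y := by
      filter_upwards [hΩo.mem_nhds ha] with z hz using hy z hz
    rw [this.deriv_eq, deriv_const]
  have hloc : ∀ c ∈ Ω, ∀ y, ¬ ∀ᶠ z in 𝓝 c, g z = y := fun c hc y hy ↦
    hnc y (han.eqOn_of_preconnected_of_eventuallyEq analyticOnNhd_const hΩc hc hy)
  refine ⟨?_, ?_, ?_⟩
  · have hcl : MapsTo g Ω (closedBall 0 1) := fun z hz ↦
      isClosed_closedBall.mem_of_tendsto (hF.tendsto_at hz)
        (.of_forall fun i ↦ ball_subset_closedBall ((hemb i).mapsTo hz))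
    have hopen : IsOpen (g '' Ω) := (han.is_constant_or_isOpen hΩc).resolve_left
      (fun ⟨y, hy⟩ ↦ hnc y hy) Ω subset_rfl hΩo
    have := hopen.subset_interior_iff.mpr hcl.image_subset
    rw [interior_closedBall _ one_ne_zero] at this
    exact mapsTo_iff_image_subset.mpr this
  · intro x hx y hy hxy
    by_contra hne
    -- `F i - F i x` has no zeros on `Ω \ {x}`, while its limit `g - g x` vanishes at `y`.
    have hx' : TendstoLocallyUniformlyOn (fun i _ ↦ F i x) (fun _ ↦ g x) φ (Ω \ {x}) :=
      ((hF.tendsto_at hx).tendstoUniformlyOn_const _).tendstoLocallyUniformlyOn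
    have hlim := (hF.mono sdiff_subset).sub hx'
    have hz := eventually_eq_zero_of_tendstoLocallyUniformlyOn (hΩo.sdiff isClosed_singleton) hlim
      (.of_forall fun i ↦ ((hemb i).differentiableOn.mono sdiff_subset).sub_const _)
      (.of_forall fun i z hz ↦ sub_ne_zero.mpr fun e ↦ hz.2 ((hemb i).injOn hz.1 hx e))
      (c := y) ⟨hy, fun e ↦ hne (Eq.symm e)⟩ (sub_eq_zero.mpr hxy.symm)
    exact hloc y hy (g x) (hz.mono fun z e ↦ sub_eq_zero.mp e)
  · intro z hz hz0
    have hev := eventually_eq_zero_of_tendstoLocallyUniformlyOn hΩo (hF.deriv hd hΩo)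
      (.of_forall fun i ↦ (hemb i).differentiableOn.deriv hΩo)
      (.of_forall fun i ↦ (hemb i).deriv_ne_zero) hz hz0
    exact hga (han.deriv.eqOn_of_preconnected_of_eventuallyEq analyticOnNhd_const hΩc hz hev ha)

/-! ### The extremal embedding -/

/-- Among the disk embeddings sending `a` to `0`, one has the largest derivative at `a`. -/
theorem exists_isDiskEmbedding_norm_deriv_max {Ω : Set ℂ} (hΩo : IsOpen Ω)
    (hΩc : IsPreconnected Ω) {a : ℂ} (ha : a ∈ Ω) (hex : ∃ f, IsDiskEmbedding Ω f) :
    ∃ g, IsDiskEmbedding Ω g ∧ g a = 0 ∧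
      ∀ f, IsDiskEmbedding Ω f → f a = 0 → ‖deriv f a‖ ≤ ‖deriv g a‖ := by
  let S : Set (ℂ → ℂ) := {f | IsDiskEmbedding Ω f ∧ f a = 0}
  let D : Set ℝ := (fun f ↦ ‖deriv f a‖) '' S
  obtain ⟨f₁, hf₁⟩ := hex
  have hf₀ : diskAut (f₁ a) ∘ f₁ ∈ S :=
    ⟨hf₁.diskAut_comp (mem_ball_zero_iff.mp (hf₁.mapsTo ha)), diskAut_self _⟩
  have hne : D.Nonempty := ⟨_, mem_image_of_mem _ hf₀⟩
  obtain ⟨r, hr, hball⟩ := Metric.isOpen_iff.mp hΩo a ha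
  have hbdd : BddAbove D := by
    refine ⟨1 / r, ?_⟩
    rintro _ ⟨f, ⟨hf, hfa⟩, rfl⟩
    refine Complex.norm_deriv_le_div_of_mapsTo_ball (hf.differentiableOn.mono hball) ?_ hr
    rw [hfa]
    exact fun z hz ↦ ball_subset_closedBall (hf.mapsTo (hball hz))
  have hle : ∀ f ∈ S, ‖deriv f a‖ ≤ sSup D := fun f hf ↦ le_csSup hbdd (mem_image_of_mem _ hf)
  -- An ultrafilter on `S` along which the derivatives at `a` approach their supremum.
  have hcomap : (comap (fun f : S ↦ ‖deriv f.1 a‖) (𝓝 (sSup D))).NeBot := by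
    refine comap_neBot fun t ht ↦ ?_
    obtain ⟨_, ht', f, hf, rfl⟩ := mem_closure_iff_nhds.mp (csSup_mem_closure hne hbdd) t ht
    exact ⟨⟨f, hf⟩, ht'⟩
  let u : Ultrafilter S := Ultrafilter.of (comap (fun f : S ↦ ‖deriv f.1 a‖) (𝓝 (sSup D)))
  have hu : Tendsto (fun f : S ↦ ‖deriv f.1 a‖) u (𝓝 (sSup D)) :=
    tendsto_comap.mono_left (Ultrafilter.of_le _)
  obtain ⟨g, hg⟩ := exists_tendstoLocallyUniformlyOn u hΩo (F := fun f : S ↦ f.1)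
    (fun f ↦ f.2.1.differentiableOn) (fun f ↦ f.2.1.mapsTo)
  have hderiv : ‖deriv g a‖ = sSup D :=
    tendsto_nhds_unique ((hg.deriv (.of_forall fun f ↦ f.2.1.differentiableOn)
      hΩo).tendsto_at ha).norm hu
  refine ⟨g, .of_tendstoLocallyUniformlyOn hΩo hΩc hg (fun f ↦ f.2.1) ha ?_, ?_,
    fun f hf hfa ↦ hderiv ▸ hle f ⟨hf, hfa⟩⟩
  · rw [← norm_pos_iff, hderiv]
    exact (norm_pos_iff.mpr (hf₀.1.deriv_ne_zero a ha)).trans_le (hle _ hf₀)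
  · exact tendsto_nhds_unique (hg.tendsto_at ha)
      (tendsto_const_nhds.congr fun f : S ↦ f.2.2.symm)

end RiemannMapping

theorem mainTheorem4 (Ω : Set ℂ) (hΩo : IsOpen Ω) (hΩc : IsSimplyConnected Ω)
    (hΩ : Ω ≠ Set.univ) (a : ℂ) (ha : a ∈ Ω) :
    ∃ f : ℂ → ℂ, DifferentiableOn ℂ f Ω ∧ (∀ z ∈ Ω, deriv f z ≠ 0) ∧
      Set.BijOn f Ω (Metric.ball (0 : ℂ) 1) ∧ f a = 0 := by
  obtain ⟨g, hg, hga, hmax⟩ := RiemannMapping.exists_isDiskEmbedding_norm_deriv_max hΩo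
    hΩc.isPathConnected.isConnected.isPreconnected ha
    (RiemannMapping.exists_isDiskEmbedding hΩo hΩc hΩ ha)
  refine ⟨g, hg.differentiableOn, hg.deriv_ne_zero, ⟨hg.mapsTo, hg.injOn, fun w hw ↦ ?_⟩, hga⟩
  by_contra hwg
  obtain ⟨f, hf, hfa, hlt⟩ := hg.exists_norm_deriv_lt hΩo hΩc ha hga (mem_ball_zero_iff.mp hw)
    (fun z hz e ↦ hwg ⟨z, hz, e⟩)
  exact absurd (hmax f hf hfa) (not_le.mpr hlt)
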